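/- All orders are linear and all groups are Abelian. A dom (double ordered monoid) is a structure $(M,\le,\mathbf 0,+,-)$ such that $(M,+,\mathbf 0)$ is a commutative monoid, $\le$ is a linear order on $M$ with $z\le z' \Rightarrow z+t\le z'+t$, and $-:M\to M$ is an order-reversing map with $-(-x)=x$, and such that, with $\delta:=-\mathbf 0$, $|x|:=\max(x,-x)$ and $x-y:=-((-x)+y)$, one has for all $x,y\in M$: (MA) $\delta\le\mathbf 0$; (MB) $|x|\ge\mathbf 0$; (MC) $x\ge y$ if and only if $x-y\ge\mathbf 0$. The width of $x$ is $\widehat x:=x-x$, and $W(M):=\{x\in M:\widehat x=x\}$. The dom $M$ is of the first type if $\delta=\mathbf 0$, of the second type if $\delta+\delta<\delta$, and of the third type if $\delta+\delta=\delta<\mathbf 0$. A sub-dom of a structure $N$ in the language $(\le,\mathbf 0,+,-)$ is a subset $A$ with $-A=A$, $A+A\subseteq A$ and $\mathbf 0\in A$. For an ordered group $G$, let $\check G$ be the set of cuts of $G$, that is, of the partitions $\Lambda=(\Lambda^L,\Lambda^R)$ of $G$ into two possibly empty subsets with $\lambda<\lambda'$ for all $\lambda\in\Lambda^L$, $\lambda'\in\Lambda^R$.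 Order $\check G$ by $\Lambda\le\Gamma$ if and only if $\Lambda^L\subseteq\Gamma^L$, and put $\mathbf 0:=((-\infty,0],(0,+\infty))$, $(\Lambda+\Gamma)^L:=\{\lambda+\gamma:\lambda\in\Lambda^L,\gamma\in\Gamma^L\}$ and $-\Lambda:=(-\Lambda^R,-\Lambda^L)$. Let $\tilde G:=G\sqcup\check G$, with order and operations extending those of $G$ and of $\check G$, with $\gamma<\Lambda$ if $\gamma\in\Lambda^L$, $\gamma>\Lambda$ if $\gamma\in\Lambda^R$, and $\gamma+\Lambda=\Lambda+\gamma:=(\gamma+\Lambda^L,\gamma+\Lambda^R)$ for $\gamma\in G$ and $\Lambda\in\check G$; the zero of $\tilde G$ is the zero of $G$. **Corollary 5.14.** Let $M$ be a dom such that $W(M)$ is finite. Then there exists an ordered group $G$ such that: 1. if $M$ is of the first type, then $M$ is isomorphic to a sub-dom of $\tilde G$; 2. if $M$ is of the second or of the third type, then $M$ is isomorphic to a sub-dom of $\check G$. -/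

import Mathlib

universe u

/-- A double ordered monoid (dom) `(M, ≤, 0, +, -)`: an Abelian linearly ordered monoid with an
order-reversing involution `-`, satisfying the axioms MA, MB and MC. Here `-((-x) + (-(-y)))` in the
last axiom is the right difference `x - y`, see `Dom.rsub` below. No cancellation and no relation
`x + (-x) = 0` is assumed. -/
class Dom (M : Type u) extends AddCommMonoid M, LinearOrder M, IsOrderedAddMonoid M,
    InvolutiveNeg M where
  /-- The minus reverses the order (being an involution, it is an anti-automorphism). -/
  neg_anti : ∀ x y : M, x ≤ y → -y ≤ -x
  /-- Axiom MA: `δ ≤ 0`, where `δ = -0`. -/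
  axiomMA : -(0 : M) ≤ 0
  /-- Axiom MB: `|x| ≥ 0`, where `|x| = max (x, -x)`. -/
  axiomMB : ∀ x : M, 0 ≤ max x (-x)
  /-- Axiom MC: `x ≥ y` if and only if `x - y ≥ 0`. -/
  axiomMC : ∀ x y : M, y ≤ x ↔ 0 ≤ -((-x) + (-(-y)))

namespace Dom

/-- The right sum `x +ᴿ y = -((-x) + (-y))`. -/
def radd {M : Type u} [Dom M] (x y : M) : M := -((-x) + (-y))

/-- The (right) difference `x - y = x +ᴿ (-y)`. -/
def rsub {M : Type u} [Dom M] (x y : M) : M := radd x (-y)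

/-- The element `δ = -0`. -/
def delta (M : Type u) [Dom M] : M := -(0 : M)

/-- The width `x - x` of `x`. -/
def width {M : Type u} [Dom M] (x : M) : M := rsub x x

/-- The set `W(M)` of the elements of `M` that are equal to their own width. -/
def widths (M : Type u) [Dom M] : Set M := {x | width x = x}

/-- First type: `δ = 0`. -/
def IsFirstType (M : Type u) [Dom M] : Prop := delta M = 0

/-- Second type: `δ + δ < δ`. -/
def IsSecondType (M : Type u) [Dom M] : Prop := delta M + delta M < delta M

/-- Third type: `δ + δ = δ < 0`. -/
def IsThirdType (M : Type u) [Dom M] : Prop :=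
  delta M + delta M = delta M ∧ delta M < 0

end Dom

/-- A dom-homomorphism between two structures in the language `(≤, 0, +, -)`. -/
structure DomHom (M N : Type u) [LE M] [Zero M] [Add M] [Neg M]
    [LE N] [Zero N] [Add N] [Neg N] where
  /-- The underlying function. -/
  toFun : M → N
  map_zero : toFun 0 = 0
  map_add : ∀ x y, toFun (x + y) = toFun x + toFun y
  map_neg : ∀ x, toFun (-x) = -toFun x
  map_le : ∀ x y, x ≤ y → toFun x ≤ toFun y

/-- A sub-dom: a symmetric subset that is closed under the sum and contains `0`. -/
structure IsSubDom {N : Type u} [Zero N] [Add N] [Neg N] (A : Set N) : Prop where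
  neg_image : (fun x => -x) '' A = A
  add_mem : ∀ x ∈ A, ∀ y ∈ A, x + y ∈ A
  zero_mem : (0 : N) ∈ A

/-- `M` is (up to isomorphism) a sub-dom of `N`: some sub-dom `A` of `N` is the image of an injective
dom-homomorphism `f` that also reflects the order, so that `f` is an isomorphism of
`(≤, 0, +, -)`-structures from `M` onto `A`. -/
def IsIsoToSubDom (M N : Type u) [LE M] [Zero M] [Add M] [Neg M]
    [LE N] [Zero N] [Add N] [Neg N] : Prop :=
  ∃ A : Set N, IsSubDom A ∧ ∃ f : DomHom M N, Function.Injective f.toFun ∧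
    (∀ x y, f.toFun x ≤ f.toFun y → x ≤ y) ∧ Set.range f.toFun = A

/-- A cut `(Λᴸ, Λᴿ)` of a linearly ordered set: a partition into two (possibly empty) subsets
such that every element of the first one is less than every element of the second one. -/
@[ext]
structure DCut (O : Type u) [LinearOrder O] where
  /-- The left part `Λᴸ`. -/
  left : Set O
  /-- The right part `Λᴿ`. -/
  right : Set O
  union_eq : left ∪ right = Set.univ
  inter_eq : left ∩ right = ∅
  lt_of_mem : ∀ a ∈ left, ∀ b ∈ right, a < b

namespace DCut

section order

variable {O : Type u} [LinearOrder O]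

/-- The cut `(S, O \ S)` determined by an initial subset `S`. -/
def ofLeft (S : Set O) (hS : IsLowerSet S) : DCut O where
  left := S
  right := Sᶜ
  union_eq := Set.union_compl_self S
  inter_eq := Set.inter_compl_self S
  lt_of_mem := fun _ ha _ hb => lt_of_not_ge fun h => hb (hS h ha)

/-- An element is in the right part of a cut if and only if it is not in the left part. -/
theorem mem_right_iff (L : DCut O) (x : O) : x ∈ L.right ↔ x ∉ L.left := by
  have h1 : x ∈ L.left ∪ L.right := by rw [L.union_eq]; trivial
  have h2 : x ∉ L.left ∩ L.right := by rw [L.inter_eq]; exact Set.notMem_empty x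
  exact ⟨fun h h' => h2 ⟨h', h⟩, fun h => h1.resolve_left h⟩

/-- The left part of a cut is an initial subset. -/
theorem isLowerSet_left (L : DCut O) : IsLowerSet L.left := by
  intro a b hba ha
  by_contra hb
  exact absurd (L.lt_of_mem a ha b ((L.mem_right_iff b).2 hb)) (not_lt.2 hba)

/-- Cuts are ordered by inclusion of the left parts. -/
instance : LE (DCut O) := ⟨fun L K => L.left ⊆ K.left⟩

end order

section group

variable {G : Type u} [AddCommGroup G] [LinearOrder G] [IsOrderedAddMonoid G]

/-- The zero of the set of cuts is `0⁺ = ((-∞, 0], (0, +∞))`. -/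
instance : Zero (DCut G) := ⟨ofLeft (Set.Iic 0) (isLowerSet_Iic 0)⟩

/-- The sumset of two initial subsets is initial. -/
theorem isLowerSet_sum (L K : DCut G) :
    IsLowerSet {z | ∃ x ∈ L.left, ∃ y ∈ K.left, z = x + y} := by
  rintro a b hba ⟨x, hx, y, hy, rfl⟩
  refine ⟨b - y, L.isLowerSet_left ?_ hx, y, hy, by abel⟩
  exact sub_le_iff_le_add.2 hba

/-- The (left) sum of cuts: `(Λ + Γ)ᴸ = {x + y : x ∈ Λᴸ, y ∈ Γᴸ}`. -/
instance : Add (DCut G) := ⟨fun L K => ofLeft _ (isLowerSet_sum L K)⟩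

/-- The minus of cuts: `-Λ = (-Λᴿ, -Λᴸ)`. -/
instance : Neg (DCut G) :=
  ⟨fun L =>
    { left := {x | -x ∈ L.right}
      right := {x | -x ∈ L.left}
      union_eq := by
        ext x
        have := L.mem_right_iff (-x)
        simp only [Set.mem_union, Set.mem_ofPred_eq, Set.mem_univ, iff_true]
        tauto
      inter_eq := by
        ext x
        have := L.mem_right_iff (-x)
        simp only [Set.mem_inter_iff, Set.mem_ofPred_eq, Set.mem_empty_iff_false, iff_false]
        tauto
      lt_of_mem := fun a ha b hb => neg_lt_neg_iff.1 (L.lt_of_mem (-b) hb (-a) ha) }⟩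

/-- The translate `g + Λ = (g + Λᴸ, g + Λᴿ)` of a cut by an element of the group. -/
def translate (g : G) (L : DCut G) : DCut G where
  left := {x | x - g ∈ L.left}
  right := {x | x - g ∈ L.right}
  union_eq := by
    ext x
    have := L.mem_right_iff (x - g)
    simp only [Set.mem_union, Set.mem_ofPred_eq, Set.mem_univ, iff_true]
    tauto
  inter_eq := by
    ext x
    have := L.mem_right_iff (x - g)
    simp only [Set.mem_inter_iff, Set.mem_ofPred_eq, Set.mem_empty_iff_false, iff_false]
    tauto
  lt_of_mem := fun a ha b hb => (sub_lt_sub_iff_right g).1 (L.lt_of_mem _ ha _ hb)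

end group

end DCut

/-- The disjoint union of an ordered group `G` and of the set of its cuts. -/
inductive GTilde (G : Type u) [LinearOrder G] : Type u
  | pt : G → GTilde G
  | cut : DCut G → GTilde G

namespace GTilde

variable {G : Type u} [AddCommGroup G] [LinearOrder G] [IsOrderedAddMonoid G]

/-- The order extends the ones on `G` and on the cuts of `G`; an element `g` of `G` is below a cut
`Λ` if `g ∈ Λᴸ`, and above it if `g ∈ Λᴿ`. -/
protected def le : GTilde G → GTilde G → Prop
  | pt a, pt b => a ≤ b
  | pt a, cut L => a ∈ L.left
  | cut L, pt a => a ∈ L.right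
  | cut L, cut K => L ≤ K

/-- The sum of an element of `G` and of a cut is the translate of the cut. -/
protected def add : GTilde G → GTilde G → GTilde G
  | pt a, pt b => pt (a + b)
  | pt a, cut L => cut (L.translate a)
  | cut L, pt a => cut (L.translate a)
  | cut L, cut K => cut (L + K)

/-- The minus extends the ones on `G` and on the cuts of `G`. -/
protected def neg : GTilde G → GTilde G
  | pt a => pt (-a)
  | cut L => cut (-L)

instance : LE (GTilde G) := ⟨GTilde.le⟩

/-- The zero is the zero of `G`. -/
instance : Zero (GTilde G) := ⟨pt 0⟩

instance : Add (GTilde G) := ⟨GTilde.add⟩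

instance : Neg (GTilde G) := ⟨GTilde.neg⟩

end GTilde

/-! The proof is by induction on the number of widths. Write `δ = -0`, and call core the set of
elements of width zero; it is closed under sum and minus. If `e` is the least positive width, the
elements of nonzero width are exactly those that absorb `e`. They form a dom with zero `e`, which
has lost the width `0` and is not of the first type because `-e < e`; by induction it consists of
cuts of an ordered group `B`. A core element `x` acts on it through `e + x`, which is invertible
there. An invertible cut is principal, so `x` acts as the translation by some `shift x` in `B`
(`UpperRep`).

It remains to lift the core to an ordered group `G` with a monotone surjection `p` onto `B`,
compatibly with `shift`. The elements of nonzero width become preimages under `p` of their cuts;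
these are unions of fibres, so they interact with the core only through `shift`.

In the first and second types the core is itself an ordered group, and
`exists_strictMono_surjective_factorization` provides `G`. In the first type the core goes to
points. In the second it goes to principal cuts, and minus is respected because `δ` is the
predecessor of `0` in `G`.

In the third type the core modulo `δ` is a group. A class containing an invertible element consists
of it and of one lesser, noninvertible element; any other class is a single element. The two
elements of a double class must be the two cuts at a point of `G`, whereas a single class must fill
a gap. Hence `G` is a dense subgroup, given by `exists_dense_addSubgroup`, of a larger group, and it
contains the double classes only. -/

/-! ### Factorization of monotone homomorphisms of ordered groups -/

/-- For `f : A → B` and a homomorphism `r` from `A` to a rational vector space `H`, there is a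
homomorphism `χ : B → H / r (ker f)` with `χ ∘ f = r` modulo `r (ker f)`. -/
theorem exists_quotient_extension {A B H : Type u} [AddCommGroup A] [AddCommGroup B]
    [AddCommGroup H] [Module ℚ H] (f : A →+ B) (r : A →+ H) :
    ∃ χ : B →+ H ⧸ (f.ker.map r), ∀ a, χ (f a) = QuotientAddGroup.mk' _ (r a) := by
  let dH : DivisibleBy H ℤ :=
    { div := fun x n => (n : ℚ)⁻¹ • x
      div_zero := fun x => by simp
      div_cancel := fun {n} x hn => by
        rw [← Int.cast_smul_eq_zsmul ℚ, smul_smul, mul_inv_cancel₀ (by exact_mod_cast hn),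
          one_smul] }
  let dQ : DivisibleBy (H ⧸ f.ker.map r) ℤ :=
    (QuotientAddGroup.mk'_surjective (f.ker.map r)).divisibleBy
      (QuotientAddGroup.mk' (f.ker.map r)) fun x n => map_zsmul _ n x
  -- A quotient of a divisible group is divisible, hence injective, so the map induced by `r`
  -- extends along `A / ker f → B`.
  have hb : Module.Baer ℤ (H ⧸ (f.ker.map r)) := Module.Baer.of_divisible _
  obtain ⟨χ, hχ⟩ := hb.extension_property_addMonoidHom (QuotientAddGroup.kerLift f)
    (QuotientAddGroup.kerLift_injective f)
    (QuotientAddGroup.map f.ker (f.ker.map r) r (AddSubgroup.le_comap_map _ _))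
  exact ⟨χ, fun a => DFunLike.congr_fun hχ (a : A ⧸ f.ker)⟩

/-- Every monotone homomorphism `f : A → B` of ordered groups factors as a strictly monotone
homomorphism into an ordered group `G` followed by a monotone surjection onto `B` with the same
kernel. -/
theorem exists_strictMono_surjective_factorization {A B : Type u} [AddCommGroup A] [LinearOrder A]
    [IsOrderedAddMonoid A] [AddCommGroup B] [LinearOrder B] [IsOrderedAddMonoid B] (f : A →+ B)
    (hf : Monotone f) :
    ∃ (G : Type u) (_ : AddCommGroup G) (_ : LinearOrder G) (_ : IsOrderedAddMonoid G)
      (i : A →+ G) (p : G →+ B), StrictMono i ∧ Monotone p ∧ Function.Surjective p ∧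
        (∀ a, p (i a) = f a) ∧ ∀ g, p g = 0 → ∃ a, i a = g := by
  have hinj : StrictMono (DivisibleHull.coeAddMonoidHom A) :=
    (DivisibleHull.coeOrderAddMonoidHom A).monotone'.strictMono_of_injective
      DivisibleHull.coe_injective
  generalize DivisibleHull.coeAddMonoidHom A = r at hinj
  obtain ⟨χ, hχ⟩ := exists_quotient_extension f r
  let fst : B ×ₗ DivisibleHull A →+ B :=
    { toFun := fun x => (ofLex x).1, map_zero' := rfl, map_add' := fun _ _ => rfl }
  let snd : B ×ₗ DivisibleHull A →+ DivisibleHull A :=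
    { toFun := fun x => (ofLex x).2, map_zero' := rfl, map_add' := fun _ _ => rfl }
  -- The group `G` is the fibre product of `B` and the divisible hull over the hull modulo `r (ker
  -- f)`. Over `0` in `B` it contains only `r (ker f)`, so the kernel does not grow.
  let S : AddSubgroup (B ×ₗ DivisibleHull A) :=
    (χ.comp fst - (QuotientAddGroup.mk' _).comp snd).ker
  have hS : ∀ x, x ∈ S ↔ χ (fst x) = QuotientAddGroup.mk' _ (snd x) := fun x => by
    simp only [S, AddMonoidHom.mem_ker, AddMonoidHom.sub_apply, sub_eq_zero]; rfl
  refine ⟨S, inferInstance, inferInstance, inferInstance,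
    { toFun := fun a => ⟨toLex (f a, r a), (hS _).2 (hχ a)⟩
      map_zero' := ?_
      map_add' := ?_ }, fst.comp S.subtype, ?_, ?_, ?_, fun _ => rfl, ?_⟩
  · apply Subtype.ext
    show toLex (f 0, r 0) = toLex (0, 0)
    rw [map_zero, map_zero]
  · intro a b
    apply Subtype.ext
    show toLex (f (a + b), r (a + b)) = toLex (f a + f b, r a + r b)
    rw [map_add, map_add]
  · intro a b hab
    show toLex (f a, r a) < toLex (f b, r b)
    rw [Prod.Lex.toLex_lt_toLex]
    exact (hf hab.le).lt_or_eq.imp_right fun h => ⟨h, hinj hab⟩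
  · intro a b hab
    rcases Prod.Lex.le_iff.1 (show a.1 ≤ b.1 from hab) with h | h
    exacts [h.le, h.1.le]
  · intro b
    obtain ⟨h, hh⟩ := QuotientAddGroup.mk'_surjective _ (χ b)
    exact ⟨⟨toLex (b, h), (hS _).2 hh.symm⟩, rfl⟩
  · rintro ⟨x, hx⟩ h0
    replace h0 : fst x = 0 := h0
    have hx' := (hS x).1 hx
    rw [h0, map_zero, eq_comm] at hx'
    obtain ⟨a, ha, hax⟩ := (QuotientAddGroup.eq_zero_iff _).1 hx'
    refine ⟨a, Subtype.ext ?_⟩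
    show toLex (f a, r a) = toLex (fst x, snd x)
    rw [h0, ← hax, f.mem_ker.1 ha]

/-! ### Arithmetic of doms and of widths -/

namespace Dom

variable {M : Type u} [Dom M]

theorem le_iff_add_neg_le (x y : M) : y ≤ x ↔ y + -x ≤ -0 := by
  rw [axiomMC, neg_neg, add_comm y]
  exact ⟨fun h => by simpa using neg_anti _ _ h, fun h => by simpa using neg_anti _ _ h⟩

/-- The residuation law, which is what MC amounts to: `-z` is the greatest element whose sum with
`z` is at most `δ`. -/
theorem le_neg_iff (y z : M) : y ≤ -z ↔ y + z ≤ -0 := by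
  rw [le_iff_add_neg_le, neg_neg]

theorem add_neg_le (x : M) : x + -x ≤ -0 := (le_iff_add_neg_le x x).1 le_rfl

/-- By MB, no element lies strictly between `δ` and `0`. -/
theorem le_neg_zero_of_neg {x : M} (h : x < 0) : x ≤ -0 := by
  rcases le_max_iff.1 (axiomMB x) with h' | h'
  · exact absurd h h'.not_gt
  · simpa using neg_anti _ _ h'

theorem nonneg_of_neg_zero_lt {x : M} (h : -0 < x) : 0 ≤ x :=
  not_lt.1 fun h' => (le_neg_zero_of_neg h').not_gt h

theorem width_eq (x : M) : width x = -(x + -x) := by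
  simp only [width, rsub, radd, neg_neg]
  rw [add_comm]

theorem le_width_iff (x z : M) : z ≤ width x ↔ z + x ≤ x := by
  rw [width_eq, le_neg_iff, ← add_assoc, ← le_iff_add_neg_le]

theorem width_nonneg (x : M) : 0 ≤ width x := (le_width_iff _ _).2 (zero_add x).le

theorem le_add_of_nonneg {x y : M} (h : 0 ≤ y) : x ≤ y + x := by
  simpa using add_le_add_left h x

theorem width_add_self (x : M) : width x + x = x :=
  le_antisymm ((le_width_iff _ _).1 le_rfl) (le_add_of_nonneg (width_nonneg x))

theorem width_add_width (x : M) : width x + width x = width x :=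
  le_antisymm ((le_width_iff _ _).2 (by rw [add_assoc, width_add_self, width_add_self]))
    (le_add_of_nonneg (width_nonneg x))

theorem width_of_idempotent {e : M} (h0 : 0 ≤ e) (he : e + e = e) : width e = e :=
  le_antisymm (((le_add_of_nonneg h0).trans_eq (add_comm _ _)).trans
    ((le_width_iff _ _).1 le_rfl)) ((le_width_iff _ _).2 he.le)

theorem width_mem_widths (x : M) : width x ∈ widths M :=
  width_of_idempotent (width_nonneg x) (width_add_width x)

theorem width_eq_zero_iff (x : M) : width x = 0 ↔ x + -x = -0 := by
  rw [width_eq, neg_eq_iff_eq_neg]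

theorem neg_lt_neg {x y : M} (h : x < y) : -y < -x :=
  lt_of_le_of_ne (neg_anti _ _ h.le) fun h' => h.ne (neg_injective h').symm

theorem width_neg (x : M) : width (-x) = width x := by
  rw [width_eq, width_eq, neg_neg, add_comm]

theorem width_zero : width (0 : M) = 0 := by rw [width_eq_zero_iff, zero_add]

theorem lt_iff_neg_zero_lt (x y : M) : x < y ↔ -0 < y + -x := by
  rw [← not_le, ← not_le, le_iff_add_neg_le]

/-- As `e > 0`, the sum `δ + e` exceeds `δ`, so it is at least `0`; adding `e` once more gives `e ≤
δ + e`. -/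
theorem neg_zero_add_of_pos {e : M} (h0 : 0 < e) (he : e + e = e) : -0 + e = e := by
  have h1 : -(0 : M) < -0 + e := by
    rw [add_comm, ← lt_iff_neg_zero_lt]; exact h0
  refine le_antisymm ?_ ?_
  · simpa using add_le_add_left (axiomMA (M := M)) e
  · have := le_add_of_nonneg (x := e) (nonneg_of_neg_zero_lt h1)
    rwa [add_assoc, he] at this

theorem width_le_width_add (x y : M) : width x ≤ width (x + y) := by
  rw [le_width_iff, ← add_assoc, width_add_self]

theorem width_eq_zero_of_add_eq_zero {x y : M} (h : x + y = 0) : width x = 0 := by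
  refine le_antisymm ?_ (width_nonneg x)
  have := width_le_width_add x y
  rwa [h, width_zero] at this

theorem neg_zero_add_neg_zero_le : (-0 : M) + -0 ≤ -0 := by
  simpa using add_le_add_left (axiomMA (M := M)) (-0)

/-- In a dom of the second type, `-(δ + δ)` is the inverse of `δ`. -/
theorem IsSecondType.neg_add_eq_zero (h : IsSecondType M) : -(-0 + -0 : M) + -0 = 0 := by
  refine le_antisymm ?_ (nonneg_of_neg_zero_lt ?_)
  · rw [← neg_neg (0 : M), le_neg_iff, neg_neg, add_assoc, add_comm]
    exact add_neg_le _
  · rw [← lt_iff_neg_zero_lt]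
    exact (neg_neg (0 : M)).symm.trans_lt (neg_lt_neg h)

theorem IsSecondType.exists_add_eq_zero (h : IsSecondType M) {x : M} (hx : width x = 0) :
    ∃ y, x + y = 0 := by
  rw [width_eq_zero_iff] at hx
  exact ⟨-x + -(-0 + -0), by rw [← add_assoc, hx, add_comm, h.neg_add_eq_zero]⟩

/-- If `δ + δ < δ`, elements of width zero are invertible, and so are their sums. Otherwise `δ` is
idempotent and `-x + -y` already sums with `x + y` to `δ`. -/
theorem width_add_eq_zero {x y : M} (hx : width x = 0) (hy : width y = 0) : width (x + y) = 0 := by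
  rcases (neg_zero_add_neg_zero_le (M := M)).lt_or_eq with h | h
  · obtain ⟨x', hx'⟩ := IsSecondType.exists_add_eq_zero h hx
    obtain ⟨y', hy'⟩ := IsSecondType.exists_add_eq_zero h hy
    exact width_eq_zero_of_add_eq_zero (y := x' + y') (by rw [add_add_add_comm, hx', hy', add_zero])
  · rw [width_eq_zero_iff] at *
    have h1 : x + y + (-x + -y) = -0 := by rw [add_add_add_comm, hx, hy, h]
    refine le_antisymm (add_neg_le _) (h1.symm.trans_le ?_)
    refine add_le_add_right ?_ _
    rw [le_neg_iff, add_comm, h1]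

end Dom

/-! ### Sums, translates and preimages of cuts -/

namespace DCut

section order

variable {O : Type u} [LinearOrder O]

theorem ext_left {L K : DCut O} (h : L.left = K.left) : L = K := by
  refine DCut.ext h (Set.ext fun x => ?_)
  rw [mem_right_iff, mem_right_iff, h]

theorem le_iff_subset {L K : DCut O} : L ≤ K ↔ L.left ⊆ K.left := Iff.rfl

theorem le_antisymm {L K : DCut O} (h : L ≤ K) (h' : K ≤ L) : L = K :=
  ext_left (Set.Subset.antisymm h h')

theorem le_of_notMem {L K : DCut O} {x : O} (hL : x ∉ L.left) (hK : x ∈ K.left) : L ≤ K :=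
  fun _ hy => (le_total x _).elim (fun h => absurd (L.isLowerSet_left h hy) hL)
    fun h => K.isLowerSet_left h hK

/-- The preimage of a cut under a monotone map. -/
def comap {P : Type u} [LinearOrder P] (p : P → O) (hp : Monotone p) (L : DCut O) : DCut P where
  left := p ⁻¹' L.left
  right := p ⁻¹' L.right
  union_eq := by rw [← Set.preimage_union, L.union_eq, Set.preimage_univ]
  inter_eq := by rw [← Set.preimage_inter, L.inter_eq, Set.preimage_empty]
  lt_of_mem := fun _ ha _ hb => hp.reflect_lt (L.lt_of_mem _ ha _ hb)

theorem mem_comap_left {P : Type u} [LinearOrder P] {p : P → O} {hp : Monotone p} {L : DCut O}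
    {x : P} : x ∈ (L.comap p hp).left ↔ p x ∈ L.left := Iff.rfl

theorem comap_le_comap_iff {P : Type u} [LinearOrder P] {p : P → O} {hp : Monotone p}
    (hs : Function.Surjective p) {L K : DCut O} : L.comap p hp ≤ K.comap p hp ↔ L ≤ K := by
  refine ⟨fun h x hx => ?_, fun h x hx => h hx⟩
  obtain ⟨y, rfl⟩ := hs x
  exact h hx

end order

section group

variable {G : Type u} [AddCommGroup G] [LinearOrder G] [IsOrderedAddMonoid G]

theorem mem_zero_left {G : Type u} [AddCommGroup G] [LinearOrder G] {x : G} :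
    x ∈ (0 : DCut G).left ↔ x ≤ 0 := Iff.rfl

theorem mem_add_left {L K : DCut G} {z : G} :
    z ∈ (L + K).left ↔ ∃ x ∈ L.left, ∃ y ∈ K.left, z = x + y := Iff.rfl

theorem mem_neg_left {L : DCut G} {x : G} : x ∈ (-L).left ↔ -x ∉ L.left := L.mem_right_iff (-x)

theorem mem_translate_left {L : DCut G} {g x : G} :
    x ∈ (L.translate g).left ↔ x - g ∈ L.left := Iff.rfl

/-- The sum of a principal cut and of a cut is a translate. -/
theorem add_eq_translate {L K : DCut G} {g : G} (h : L.left = Set.Iic g) :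
    L + K = K.translate g := by
  apply ext_left
  ext z
  rw [mem_add_left, mem_translate_left, h]
  constructor
  · rintro ⟨x, hx, y, hy, rfl⟩
    refine K.isLowerSet_left ?_ hy
    rw [sub_le_iff_le_add, add_comm]
    exact add_le_add_right hx y
  · exact fun hz => ⟨g, le_rfl, z - g, hz, by abel⟩

theorem translate_left_of_eq_Iic {K : DCut G} {g h : G} (hK : K.left = Set.Iic h) :
    (K.translate g).left = Set.Iic (g + h) := by
  ext z
  rw [mem_translate_left, hK, Set.mem_Iic, Set.mem_Iic, sub_le_iff_le_add']

/-- An invertible cut is principal. -/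
theorem exists_left_eq_Iic {L K : DCut G} (h : L + K = 0) : ∃ g, L.left = Set.Iic g := by
  -- Since `0 = x + y` is the greatest element of the left part of `L + K`, `x` is the greatest of
  -- that of `L`.
  obtain ⟨x, hx, y, hy, hxy⟩ := mem_add_left.1 (h ▸ mem_zero_left.2 le_rfl : (0 : G) ∈ (L + K).left)
  refine ⟨x, Set.ext fun z => ⟨fun hz => ?_, fun hz => L.isLowerSet_left hz hx⟩⟩
  have : z + y ∈ (L + K).left := ⟨z, hz, y, hy, rfl⟩
  rw [h, mem_zero_left, hxy] at this
  exact le_of_add_le_add_right this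

variable {B : Type u} [AddCommGroup B] [LinearOrder B] [IsOrderedAddMonoid B]
  {p : G →+ B} {hp : Monotone p}

theorem comap_add (hs : Function.Surjective p) (L K : DCut B) :
    (L + K).comap p hp = L.comap p hp + K.comap p hp := by
  apply ext_left
  ext z
  constructor
  · rintro ⟨x, hx, y, hy, h⟩
    obtain ⟨x, rfl⟩ := hs x
    refine ⟨x, hx, z - x, ?_, by abel⟩
    rw [mem_comap_left, map_sub, h, add_sub_cancel_left]
    exact hy
  · rintro ⟨x, hx, y, hy, rfl⟩
    exact ⟨p x, hx, p y, hy, map_add p x y⟩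

theorem comap_neg (L : DCut B) : (-L).comap p hp = -L.comap p hp := by
  apply ext_left
  ext z
  rw [mem_comap_left, mem_neg_left, mem_neg_left, mem_comap_left, map_neg]

theorem comap_translate (g : G) (L : DCut B) :
    (L.translate (p g)).comap p hp = (L.comap p hp).translate g := by
  apply ext_left
  ext z
  rw [mem_comap_left, mem_translate_left, mem_translate_left, mem_comap_left, map_sub]

/-- Adding to the preimage of a cut a cut that contains a point over `b` and lies below the fibre
over `b`. -/
theorem add_comap {C : DCut G} {b : B} (h : ∃ g ∈ C.left, p g = b) (h' : ∀ g ∈ C.left, p g ≤ b)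
    (L : DCut B) : C + L.comap p hp = (L.translate b).comap p hp := by
  apply ext_left
  ext z
  rw [mem_comap_left, mem_translate_left]
  constructor
  · rintro ⟨x, hx, y, hy, rfl⟩
    refine L.isLowerSet_left ?_ hy
    rw [map_add, sub_le_iff_le_add']
    exact add_le_add_left (h' x hx) _
  · intro hz
    obtain ⟨g, hg, rfl⟩ := h
    exact ⟨g, hg, z - g, by rwa [mem_comap_left, map_sub], by abel⟩

protected theorem add_comm (L K : DCut G) : L + K = K + L :=
  ext_left <| Set.ext fun _ => ⟨fun ⟨x, hx, y, hy, h⟩ => ⟨y, hy, x, hx, h.trans (add_comm _ _)⟩,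
    fun ⟨x, hx, y, hy, h⟩ => ⟨y, hy, x, hx, h.trans (add_comm _ _)⟩⟩

end group

end DCut

/-! ### Gluing the core to the elements of nonzero width -/

/-- An injective map that preserves and reflects the structure is an isomorphism onto a sub-dom. -/
theorem isIsoToSubDom_of_map {M N : Type u} [LE M] [Zero M] [Add M] [InvolutiveNeg M] [LE N]
    [Zero N] [Add N] [Neg N] (f : M → N) (h0 : f 0 = 0) (hadd : ∀ x y, f (x + y) = f x + f y)
    (hneg : ∀ x, f (-x) = -f x) (hle : ∀ x y, x ≤ y ↔ f x ≤ f y) (hinj : Function.Injective f) :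
    IsIsoToSubDom M N := by
  refine ⟨Set.range f, ⟨?_, ?_, ⟨0, h0⟩⟩, ⟨f, h0, hadd, hneg, fun x y => (hle x y).1⟩, hinj,
    fun x y => (hle x y).2, rfl⟩
  · ext y
    constructor
    · rintro ⟨_, ⟨x, rfl⟩, rfl⟩
      exact ⟨-x, hneg x⟩
    · rintro ⟨x, rfl⟩
      exact ⟨f (-x), ⟨-x, rfl⟩, (hneg _).symm.trans (congrArg f (neg_neg x))⟩
  · rintro _ ⟨x, rfl⟩ _ ⟨y, rfl⟩
    exact ⟨x + y, hadd x y⟩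

/-- A representation, by the cuts of an ordered group `B`, of the elements of nonzero width of a dom,
together with the action by translations of the elements of width zero. -/
structure UpperRep (M : Type u) [Dom M] (B : Type u) [AddCommGroup B] [LinearOrder B]
    [IsOrderedAddMonoid B] where
  /-- The element of `B` by which an element of width zero translates. -/
  shift : M → B
  /-- The cut that represents an element of nonzero width. -/
  cut : M → DCut B
  shift_add : ∀ x y, Dom.width x = 0 → Dom.width y = 0 → shift (x + y) = shift x + shift y
  shift_mono : ∀ x y, Dom.width x = 0 → Dom.width y = 0 → x ≤ y → shift x ≤ shift y
  shift_neg_zero : shift (-0) = 0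
  cut_add : ∀ x y, Dom.width x ≠ 0 → Dom.width y ≠ 0 → cut (x + y) = cut x + cut y
  cut_neg : ∀ x, Dom.width x ≠ 0 → cut (-x) = -cut x
  cut_le_iff : ∀ x y, Dom.width x ≠ 0 → Dom.width y ≠ 0 → (x ≤ y ↔ cut x ≤ cut y)
  cut_add_core : ∀ x y, Dom.width x = 0 → Dom.width y ≠ 0 →
    cut (x + y) = (cut y).translate (shift x)
  le_iff : ∀ x y, Dom.width x = 0 → Dom.width y ≠ 0 → (x ≤ y ↔ shift x ∈ (cut y).left)

namespace UpperRep

open Dom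

variable {M : Type u} [Dom M] {B : Type u} [AddCommGroup B] [LinearOrder B]
  [IsOrderedAddMonoid B] (U : UpperRep M B)

theorem shift_zero : U.shift 0 = 0 := by
  simpa using U.shift_add 0 0 width_zero width_zero

theorem le_iff' {x y : M} (hx : width x ≠ 0) (hy : width y = 0) :
    x ≤ y ↔ U.shift y ∉ (U.cut x).left := by
  rw [← U.le_iff y x hy hx, not_le]
  exact ⟨fun h => lt_of_le_of_ne h (by rintro rfl; exact hx hy), le_of_lt⟩

theorem width_add_ne_zero {x y : M} (hx : width x ≠ 0) : width (x + y) ≠ 0 := fun h =>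
  hx (le_antisymm ((width_le_width_add x y).trans_eq h) (width_nonneg x))

variable {G : Type u} [AddCommGroup G] [LinearOrder G] [IsOrderedAddMonoid G]
  {p : G →+ B}

open Classical in
/-- A representation of the elements of width zero by cuts of `G`, compatible with the translations,
and a representation of the other elements by cuts of a quotient of `G` glue together. -/
theorem isIsoToSubDom_cut (hp : Monotone p) (hs : Function.Surjective p) (c : M → DCut G)
    (c_zero : c 0 = 0)
    (c_add : ∀ x y, width x = 0 → width y = 0 → c (x + y) = c x + c y)
    (c_neg : ∀ x, width x = 0 → c (-x) = -c x)
    (c_le_iff : ∀ x y, width x = 0 → width y = 0 → (x ≤ y ↔ c x ≤ c y))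
    (exists_mem : ∀ x, width x = 0 → ∃ g ∈ (c x).left, p g = U.shift x)
    (exists_notMem : ∀ x, width x = 0 → ∃ g ∉ (c x).left, p g = U.shift x)
    (le_shift : ∀ x, width x = 0 → ∀ g ∈ (c x).left, p g ≤ U.shift x) :
    IsIsoToSubDom M (DCut G) := by
  set f : M → DCut G := fun x => if width x = 0 then c x else (U.cut x).comap p hp with hf
  have f0 : ∀ x, width x = 0 → f x = c x := fun x hx => if_pos hx
  have f1 : ∀ x, width x ≠ 0 → f x = (U.cut x).comap p hp := fun x hx => if_neg hx
  have add' : ∀ x y, width x = 0 → width y ≠ 0 → f (x + y) = f x + f y := fun x y hx hy => by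
    rw [f0 x hx, f1 y hy, f1 _ (by rw [add_comm]; exact width_add_ne_zero hy),
      U.cut_add_core x y hx hy, DCut.add_comap (exists_mem x hx) (le_shift x hx)]
  have hle : ∀ x y, x ≤ y ↔ f x ≤ f y := fun x y => by
    by_cases hx : width x = 0 <;> by_cases hy : width y = 0
    · rw [f0 x hx, f0 y hy, c_le_iff x y hx hy]
    · rw [f0 x hx, f1 y hy, U.le_iff x y hx hy]
      refine ⟨fun h g hg => (U.cut y).isLowerSet_left (le_shift x hx g hg) h, fun h => ?_⟩
      obtain ⟨g, hg, hgx⟩ := exists_mem x hx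
      exact hgx ▸ h hg
    · rw [f1 x hx, f0 y hy, U.le_iff' hx hy]
      constructor
      · intro h
        obtain ⟨g, hg, hgy⟩ := exists_mem y hy
        exact DCut.le_of_notMem (x := g) (by rwa [DCut.mem_comap_left, hgy]) hg
      -- The preimage of `U.cut x` would contain the whole fibre over `U.shift y`, but `c y` does
      -- not.
      · intro h h'
        obtain ⟨g, hg, hgy⟩ := exists_notMem y hy
        exact hg (h (by rwa [DCut.mem_comap_left, hgy]))
    · rw [f1 x hx, f1 y hy, U.cut_le_iff x y hx hy, DCut.comap_le_comap_iff hs]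
  have hrefl : ∀ a : DCut G, a ≤ a := fun a => subset_refl a.left
  refine isIsoToSubDom_of_map f (by rw [f0 0 width_zero, c_zero]) (fun x y => ?_) (fun x => ?_) hle
    fun x y h => le_antisymm ((hle x y).2 (h ▸ hrefl _)) ((hle y x).2 (h ▸ hrefl _))
  · by_cases hx : width x = 0 <;> by_cases hy : width y = 0
    · rw [f0 x hx, f0 y hy, f0 _ (width_add_eq_zero hx hy), c_add x y hx hy]
    · exact add' x y hx hy
    · rw [add_comm, add' y x hy hx, DCut.add_comm]
    · rw [f1 x hx, f1 y hy, f1 _ (width_add_ne_zero hx), U.cut_add x y hx hy, DCut.comap_add hs]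
  · have := width_neg x
    by_cases hx : width x = 0
    · rw [f0 x hx, f0 _ (this.trans hx), c_neg x hx]
    · rw [f1 x hx, f1 _ (this.trans_ne hx), U.cut_neg x hx, DCut.comap_neg]

/-- A representation of the elements of width zero by elements of `G`, compatible with the
translations, and a representation of the other elements by cuts of a quotient of `G` glue
together. -/
theorem isIsoToSubDom_gTilde (hp : Monotone p) (hs : Function.Surjective p) (i : M → G)
    (i_zero : i 0 = 0)
    (i_add : ∀ x y, width x = 0 → width y = 0 → i (x + y) = i x + i y)
    (i_neg : ∀ x, width x = 0 → i (-x) = -i x)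
    (i_le_iff : ∀ x y, width x = 0 → width y = 0 → (x ≤ y ↔ i x ≤ i y))
    (p_apply : ∀ x, width x = 0 → p (i x) = U.shift x) :
    IsIsoToSubDom M (GTilde G) := by
  classical
  set f : M → GTilde G :=
    fun x => if width x = 0 then .pt (i x) else .cut ((U.cut x).comap p hp) with hf
  have f0 : ∀ x, width x = 0 → f x = .pt (i x) := fun x hx => if_pos hx
  have f1 : ∀ x, width x ≠ 0 → f x = .cut ((U.cut x).comap p hp) := fun x hx => if_neg hx
  have key : ∀ x y, width x = 0 → width y ≠ 0 →
      f (x + y) = .cut (((U.cut y).comap p hp).translate (i x)) := fun x y hx hy => by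
    rw [f1 _ (by rw [add_comm]; exact width_add_ne_zero hy),
      U.cut_add_core x y hx hy, ← p_apply x hx, DCut.comap_translate]
  have hle : ∀ x y, x ≤ y ↔ f x ≤ f y := fun x y => by
    by_cases hx : width x = 0 <;> by_cases hy : width y = 0
    · rw [f0 x hx, f0 y hy, i_le_iff x y hx hy]; rfl
    · rw [f0 x hx, f1 y hy, U.le_iff x y hx hy, ← p_apply x hx]; rfl
    · rw [f1 x hx, f0 y hy, U.le_iff' hx hy, ← p_apply y hy, ← DCut.mem_right_iff]; rfl
    · rw [f1 x hx, f1 y hy, U.cut_le_iff x y hx hy, ← DCut.comap_le_comap_iff hs]; rfl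
  have hrefl : ∀ a : GTilde G, a ≤ a := fun a => by
    cases a
    · exact le_refl (α := G) _
    · exact subset_refl (α := Set G) _
  refine isIsoToSubDom_of_map f (by rw [f0 0 width_zero, i_zero]; rfl) (fun x y => ?_) (fun x => ?_)
    hle fun x y h => le_antisymm ((hle x y).2 (h ▸ hrefl _)) ((hle y x).2 (h ▸ hrefl _))
  · by_cases hx : width x = 0 <;> by_cases hy : width y = 0
    · rw [f0 x hx, f0 y hy, f0 _ (width_add_eq_zero hx hy), i_add x y hx hy]; rfl
    · rw [key x y hx hy, f0 x hx, f1 y hy]; rfl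
    · rw [add_comm, key y x hy hx, f0 y hy, f1 x hx]; rfl
    · rw [f1 x hx, f1 y hy, f1 _ (width_add_ne_zero hx), U.cut_add x y hx hy, DCut.comap_add hs]
      rfl
  · have := width_neg x
    by_cases hx : width x = 0
    · rw [f0 x hx, f0 _ (this.trans hx), i_neg x hx]; rfl
    · rw [f1 x hx, f1 _ (this.trans_ne hx), U.cut_neg x hx, DCut.comap_neg]; rfl

end UpperRep

/-! ### The dom of absorbing elements and the inductive step -/

namespace Dom

/-- The elements that absorb an idempotent `e`. They form a monoid with zero `e`. -/
def Absorbing {M : Type u} [Dom M] (e : M) (_he : e + e = e) : Type u := {x : M // e + x = x}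

namespace Absorbing

variable {M : Type u} [Dom M] {e : M} {he : e + e = e}

instance : LinearOrder (Absorbing e he) := inferInstanceAs (LinearOrder {x : M // e + x = x})

/-- The projection `x ↦ e + x`. -/
def proj (he : e + e = e) (x : M) : Absorbing e he := ⟨e + x, by rw [← add_assoc, he]⟩

instance : Add (Absorbing e he) := ⟨fun x y => ⟨x.1 + y.1, by rw [← add_assoc, x.2]⟩⟩

instance : Zero (Absorbing e he) := ⟨⟨e, he⟩⟩

instance : AddCommMonoid (Absorbing e he) where
  add_assoc _ _ _ := Subtype.ext (add_assoc _ _ _)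
  add_comm _ _ := Subtype.ext (add_comm _ _)
  zero_add x := Subtype.ext x.2
  add_zero x := Subtype.ext ((add_comm _ _).trans x.2)
  nsmul := nsmulRec

theorem val_add (x y : Absorbing e he) : (x + y).1 = x.1 + y.1 := rfl

theorem le_iff_val {x y : Absorbing e he} : x ≤ y ↔ x.1 ≤ y.1 := Iff.rfl

instance : IsOrderedAddMonoid (Absorbing e he) where
  add_le_add_left _ _ h z := add_le_add_left (α := M) h z.1

theorem proj_add (x y : M) : proj he (x + y) = proj he x + proj he y :=
  Subtype.ext (by rw [val_add]; simp only [proj]; rw [add_add_add_comm, he])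

theorem proj_zero : proj he 0 = 0 := Subtype.ext (add_zero e)

theorem proj_mono {x y : M} (h : x ≤ y) : proj he x ≤ proj he y := add_le_add_right (α := M) h e

theorem neg_absorb {x : M} (h0 : 0 ≤ e) (hx : e + x = x) : e + -x = -x := by
  refine le_antisymm ?_ (le_add_of_nonneg h0)
  rw [← hx, ← width_add_self x] at *
  rw [le_neg_iff, add_assoc, add_comm (-_), ← add_assoc, hx]
  exact add_neg_le _

/-- The elements absorbing a nonnegative idempotent form a dom. -/
@[reducible]
def dom (he : e + e = e) (h0 : 0 ≤ e) : Dom (Absorbing e he) where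
  neg x := ⟨-x.1, neg_absorb h0 x.2⟩
  neg_neg x := Subtype.ext (neg_neg x.1)
  neg_anti x y h := neg_anti x.1 y.1 h
  axiomMA := (neg_anti 0 e h0).trans ((axiomMA (M := M)).trans h0)
  axiomMB x := by
    rcases le_max_iff.1 (axiomMB x.1) with h | h
    · exact le_max_of_le_left (((le_add_of_nonneg h).trans_eq (add_comm _ _)).trans_eq x.2)
    · exact le_max_of_le_right
        (((le_add_of_nonneg h).trans_eq (add_comm _ _)).trans_eq (neg_absorb h0 x.2))
  axiomMC x y := by
    have hz : e + (-x.1 + - -y.1) = -x.1 + - -y.1 := by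
      rw [← add_assoc, neg_absorb h0 x.2]
    refine (axiomMC x.1 y.1).trans ⟨fun h => ?_, h0.trans⟩
    exact ((le_add_of_nonneg h).trans_eq (add_comm _ _)).trans_eq (neg_absorb h0 hz)

end Absorbing

variable {M : Type u} [Dom M]

theorem width_ne_zero_of_absorb {e x : M} (h0 : 0 < e) (hx : e + x = x) : width x ≠ 0 :=
  (h0.trans_le ((le_width_iff x e).2 hx.le)).ne'

theorem absorb_of_width_ne_zero {e x : M} (h0 : 0 ≤ e)
    (hmin : ∀ w ∈ widths M, w ≠ 0 → e ≤ w) (hx : width x ≠ 0) : e + x = x :=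
  le_antisymm ((le_width_iff x e).1 (hmin _ (width_mem_widths x) hx)) (le_add_of_nonneg h0)

theorem nonneg_of_mem_widths {w : M} (h : w ∈ widths M) : 0 ≤ w :=
  (width_nonneg w).trans_eq h

theorem add_self_of_mem_widths {w : M} (h : w ∈ widths M) : w + w = w := by
  have := width_add_width w
  rwa [show width w = w from h] at this

/-- The width `0` is lost, which makes the induction decrease. -/
theorem Absorbing.widths_image_subset {e : M} (he : e + e = e) (h0 : 0 < e) :
    letI := Absorbing.dom he h0.le
    Subtype.val '' widths (Absorbing e he) ⊆ widths M \ {0} := by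
  rintro _ ⟨x, hx, rfl⟩
  refine ⟨congrArg Subtype.val hx, fun hx0 => ?_⟩
  exact width_ne_zero_of_absorb h0 x.2 ((congrArg width hx0).trans width_zero)

/-- A representation by cuts of the elements absorbing the least positive width yields a
representation of the elements of nonzero width. -/
theorem exists_upperRep_of_absorbing {e : M} (he : e + e = e) (h0 : 0 < e)
    (hmin : ∀ w ∈ widths M, w ≠ 0 → e ≤ w) {B : Type u} [AddCommGroup B] [LinearOrder B]
    [IsOrderedAddMonoid B]
    (h : letI := Absorbing.dom he h0.le; IsIsoToSubDom (Absorbing e he) (DCut B)) :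
    Nonempty (UpperRep M B) := by
  let _ := Absorbing.dom he h0.le
  obtain ⟨_, _, f, -, hf, -⟩ := h
  have hle : ∀ x y, x ≤ y ↔ f.toFun x ≤ f.toFun y := fun x y => ⟨f.map_le x y, hf x y⟩
  have habs : ∀ {x : M}, width x ≠ 0 → e + x = x := absorb_of_width_ne_zero h0.le hmin
  let c : M → DCut B := fun x => f.toFun (Absorbing.proj he x)
  have c_add : ∀ x y, c (x + y) = c x + c y := fun x y => by
    simp only [c]; rw [Absorbing.proj_add, f.map_add]
  have c_delta : c (-0) = 0 := by
    simp only [c]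
    rw [← f.map_zero]
    exact congrArg f.toFun (Subtype.ext ((add_comm _ _).trans (neg_zero_add_of_pos h0 he)))
  -- For `x` of width zero, `c x + c (-x) = c δ = 0`, so `c x` is principal; its greatest element is
  -- the shift. Elsewhere `0` is a dummy value.
  have hs : ∀ x, ∃ g, width x = 0 → (c x).left = Set.Iic g := fun x => by
    by_cases hx : width x = 0
    · obtain ⟨g, hg⟩ := DCut.exists_left_eq_Iic (L := c x) (K := c (-x)) (by
        rw [← c_add, (width_eq_zero_iff x).1 hx, c_delta])
      exact ⟨g, fun _ => hg⟩
    · exact ⟨0, fun h => absurd h hx⟩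
  choose s hs using hs
  refine ⟨⟨s, c, fun x y hx hy => ?_, fun x y hx hy hxy => ?_, ?_, fun x y _ _ => c_add x y,
    fun x hx => ?_, fun x y hx hy => ?_, fun x y hx _ => ?_, fun x y hx hy => ?_⟩⟩
  · rw [← Set.Iic_inj, ← hs _ (width_add_eq_zero hx hy), c_add, DCut.add_eq_translate (hs x hx),
      DCut.translate_left_of_eq_Iic (hs y hy)]
  · rw [← Set.Iic_subset_Iic, ← hs x hx, ← hs y hy]
    exact f.map_le _ _ (Absorbing.proj_mono hxy)
  · rw [← Set.Iic_inj, ← hs _ ((width_neg _).trans width_zero), c_delta]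
    rfl
  · simp only [c]
    rw [← f.map_neg]
    refine congrArg f.toFun (Subtype.ext ?_)
    exact (Absorbing.neg_absorb h0.le (habs hx)).trans (congrArg Neg.neg (habs hx).symm)
  · simp only [c]
    rw [← hle, Absorbing.le_iff_val]
    simp only [Absorbing.proj]
    rw [habs hx, habs hy]
  · rw [c_add, DCut.add_eq_translate (hs x hx)]
  · have h1 : x ≤ y ↔ c x ≤ c y := by
      simp only [c]
      rw [← hle, Absorbing.le_iff_val]
      simp only [Absorbing.proj]
      rw [habs hy]
      exact ⟨fun h => (add_le_add_right h e).trans_eq (habs hy),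
        (le_add_of_nonneg h0.le).trans⟩
    rw [h1, DCut.le_iff_subset, hs x hx]
    exact ⟨fun h => h Set.self_mem_Iic, fun h z hz => (c y).isLowerSet_left hz h⟩

/-- The elements of nonzero width have a representation by cuts as soon as the doms that have fewer
widths and are not of the first type do. -/
theorem exists_upperRep (M : Type u) [Dom M] (hW : (widths M).Finite)
    (IH : ∀ (N : Type u) [Dom N], (widths N).Finite → (widths N).ncard < (widths M).ncard →
      ¬ IsFirstType N → ∃ (G : Type u) (_ : AddCommGroup G) (_ : LinearOrder G)
        (_ : IsOrderedAddMonoid G), IsIsoToSubDom N (DCut G)) :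
    ∃ (B : Type u) (_ : AddCommGroup B) (_ : LinearOrder B) (_ : IsOrderedAddMonoid B),
      Nonempty (UpperRep M B) := by
  by_cases hM : ∀ x : M, width x = 0
  · exact ⟨PUnit, inferInstance, inferInstance, inferInstance,
      ⟨⟨fun _ => 0, fun _ => 0, fun _ _ _ _ => rfl, fun _ _ _ _ _ => le_rfl, rfl,
      fun x _ hx => absurd (hM x) hx, fun x hx => absurd (hM x) hx,
      fun x _ hx => absurd (hM x) hx, fun _ y _ hy => absurd (hM y) hy,
      fun _ y _ hy => absurd (hM y) hy⟩⟩⟩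
  · push Not at hM
    obtain ⟨x, hx⟩ := hM
    obtain ⟨e, ⟨heW, he0⟩, hmin⟩ := Set.exists_min_image (widths M \ {0}) id
      (hW.subset Set.sdiff_subset)
      ⟨width x, width_mem_widths x, hx⟩
    have h0 : 0 < e := lt_of_le_of_ne (nonneg_of_mem_widths heW) (Ne.symm he0)
    have he := add_self_of_mem_widths heW
    let _ := Absorbing.dom he h0.le
    have hsub := Absorbing.widths_image_subset he h0
    have hzero : (0 : M) ∈ widths M := width_zero
    obtain ⟨B, _, _, _, hB⟩ := IH (Absorbing e he)
      (Set.Finite.of_finite_image ((hW.subset Set.sdiff_subset).subset hsub)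
        Subtype.val_injective.injOn) (by
        rw [← Set.ncard_image_of_injective (widths (Absorbing e he)) Subtype.val_injective]
        exact (Set.ncard_le_ncard hsub (hW.subset Set.sdiff_subset)).trans_lt
          (Set.ncard_sdiff_singleton_lt_of_mem hzero hW))
      (fun h => by
        have h1 : -e = e := congrArg Subtype.val h
        have h2 : -e ≤ -0 := neg_anti _ _ h0.le
        exact (h2.trans axiomMA).not_gt (h1.symm ▸ h0))
    exact ⟨B, _, _, _, exists_upperRep_of_absorbing he h0 (fun w hw hw0 => hmin w ⟨hw, hw0⟩) hB⟩

end Dom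

/-! ### Dense subgroups -/

/-- Every ordered group `A` embeds in an ordered group `E` that has a dense subgroup meeting `A` in a
prescribed subgroup `S`. Moreover `E` has a monotone retraction onto `A` with nontrivial kernel. -/
theorem exists_dense_addSubgroup {A : Type u} [AddCommGroup A] [LinearOrder A]
    [IsOrderedAddMonoid A] (S : AddSubgroup A) :
    ∃ (E : Type u) (_ : AddCommGroup E) (_ : LinearOrder E) (_ : IsOrderedAddMonoid E)
      (T : AddSubgroup E) (j : A →+ E) (q : E →+ A), StrictMono j ∧ Monotone q ∧
        (∀ a, q (j a) = a) ∧ (∀ a, j a ∈ T ↔ a ∈ S) ∧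
        (∀ a b, a < b → ∃ t ∈ T, a < t ∧ t < b) ∧ ∃ ε, 0 < ε ∧ q ε = 0 := by
  classical
  have hpos : (0 : A ×ₗ ℤ) < toLex (0, 1) :=
    (Prod.Lex.toLex_lt_toLex).2 (Or.inr ⟨rfl, one_pos⟩)
  have hconst : ∀ a b : A ×ₗ ℤ, a < b → (toLex fun _ : ℕ => a) < toLex fun _ => b :=
    fun a b h => ⟨0, fun j hj => absurd hj (Nat.not_lt_zero j), h⟩
  -- `A` sits in `E` as constant sequences, and `T` consists of the sequences eventually equal to
  -- some `(a, 0)` with `a ∈ S`; only the tail decides membership.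
  refine ⟨Lex (ℕ → A ×ₗ ℤ), inferInstance, inferInstance, inferInstance,
    { carrier := {s | ∃ a ∈ S, ∃ n, ∀ m, n ≤ m → ofLex s m = toLex (a, 0)}
      zero_mem' := ⟨0, S.zero_mem, 0, fun _ _ => rfl⟩
      add_mem' := ?_
      neg_mem' := ?_ },
    { toFun := fun a => toLex fun _ => toLex (a, 0)
      map_zero' := rfl
      map_add' := fun a b => ?_ },
    { toFun := fun s => (ofLex (ofLex s 0)).1
      map_zero' := rfl
      map_add' := fun _ _ => rfl }, ?_, ?_, fun _ => rfl, ?_, ?_,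
    toLex fun _ => toLex (0, 1), ?_, rfl⟩
  · rintro s t ⟨a, ha, n, hn⟩ ⟨b, hb, m, hm⟩
    refine ⟨a + b, S.add_mem ha hb, max n m, fun k hk => ?_⟩
    show ofLex s k + ofLex t k = _
    rw [hn k ((le_max_left _ _).trans hk), hm k ((le_max_right _ _).trans hk)]
    rfl
  · rintro s ⟨a, ha, n, hn⟩
    refine ⟨-a, S.neg_mem ha, n, fun k hk => ?_⟩
    show -ofLex s k = _
    rw [hn k hk]
    rfl
  · rfl
  · exact fun a b h => hconst _ _ (Prod.Lex.toLex_lt_toLex.2 (Or.inl h))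
  · intro s t h
    have h0 : ofLex s 0 ≤ ofLex t 0 := by
      rcases h.lt_or_eq with ⟨n, hn, hlt⟩ | rfl
      · rcases Nat.eq_zero_or_pos n with rfl | h
        exacts [hlt.le, (hn 0 h).le]
      · exact le_rfl
    rcases Prod.Lex.le_iff.1 h0 with h | h
    exacts [h.le, h.1.le]
  · intro a
    constructor
    · rintro ⟨b, hb, n, hn⟩
      have : a = b := congrArg (fun z => (ofLex z).1) (hn n le_rfl)
      rwa [this]
    · exact fun ha => ⟨a, ha, 0, fun _ _ => rfl⟩
  · rintro a b ⟨n, hn, hlt⟩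
    -- Agreeing with `a` through `n` keeps the sequence below `b`; the increment at `n + 1` puts it
    -- above `a`; the zero tail puts it in `T`.
    refine ⟨toLex fun k => if k ≤ n then ofLex a k else if k = n + 1 then
      ofLex a k + toLex (0, 1) else 0, ⟨0, S.zero_mem, n + 2, fun m hm => ?_⟩,
      ⟨n + 1, fun k hk => ?_, ?_⟩, ⟨n, fun k hk => ?_, ?_⟩⟩
    · exact (if_neg (by omega)).trans (if_neg (by omega))
    · exact (if_pos (by omega)).symm
    · exact (lt_add_of_pos_right _ hpos).trans_eq
        ((if_neg (by omega)).trans (if_pos rfl)).symm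
    · exact (if_pos hk.le).trans (hn k hk)
    · exact (if_pos le_rfl).trans_lt hlt
  · exact hconst _ _ hpos

/-! ### Representation of the core in each of the three types -/

namespace UpperRep

open Dom

variable {M : Type u} [Dom M] {B : Type u} [AddCommGroup B] [LinearOrder B]
  [IsOrderedAddMonoid B]

theorem width_addUnits (a : AddUnits M) : width (a : M) = 0 :=
  width_eq_zero_of_add_eq_zero a.add_neg

/-- If the elements of width zero are invertible, they embed in an ordered group that maps onto
`B`. -/
theorem exists_embedding_of_invertible (U : UpperRep M B)
    (hinv : ∀ x : M, width x = 0 → ∃ y, x + y = 0) :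
    ∃ (G : Type u) (_ : AddCommGroup G) (_ : LinearOrder G) (_ : IsOrderedAddMonoid G)
      (i : M → G) (p : G →+ B), Monotone p ∧ Function.Surjective p ∧
        (∀ x y, width x = 0 → width y = 0 → i (x + y) = i x + i y) ∧
        (∀ x y, width x = 0 → width y = 0 → (x ≤ y ↔ i x ≤ i y)) ∧
        (∀ x, width x = 0 → p (i x) = U.shift x) ∧
        ∀ g, p g = 0 → ∃ x, width x = 0 ∧ i x = g := by
  have h : ∀ x : M, ∃ a : AddUnits M, width x = 0 → (a : M) = x := fun x => by
    by_cases hx : width x = 0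
    · obtain ⟨y, hy⟩ := hinv x hx
      exact ⟨⟨x, y, hy, (add_comm _ _).trans hy⟩, fun _ => rfl⟩
    · exact ⟨0, fun h => absurd h hx⟩
  choose τ hτ using h
  let f : AddUnits M →+ B :=
    { toFun := fun a => U.shift a
      map_zero' := U.shift_zero
      map_add' := fun a b => U.shift_add a b (width_addUnits a) (width_addUnits b) }
  obtain ⟨G, _, _, _, i, p, hi, hp, hs, hpi, hker⟩ :=
    exists_strictMono_surjective_factorization f
      fun a b h => U.shift_mono a b (width_addUnits a) (width_addUnits b) h
  refine ⟨G, _, _, inferInstance, fun x => i (τ x), p, hp, hs, fun x y hx hy => ?_,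
    fun x y hx hy => ?_, fun x hx => ?_, fun g hg => ?_⟩
  · rw [← map_add]
    refine congrArg i (AddUnits.ext ?_)
    rw [AddUnits.val_add, hτ x hx, hτ y hy, hτ _ (width_add_eq_zero hx hy)]
  · rw [hi.le_iff_le, ← AddUnits.val_le_val, hτ x hx, hτ y hy]
  · rw [hpi]
    exact congrArg U.shift (hτ x hx)
  · obtain ⟨a, rfl⟩ := hker g hg
    exact ⟨a, width_addUnits a, congrArg i (AddUnits.ext (hτ _ (width_addUnits a)))⟩

theorem isIsoToSubDom_of_isFirstType (U : UpperRep M B) (hM : IsFirstType M) :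
    ∃ (G : Type u) (_ : AddCommGroup G) (_ : LinearOrder G) (_ : IsOrderedAddMonoid G),
      IsIsoToSubDom M (GTilde G) := by
  have hM' : -(0 : M) = 0 := hM
  obtain ⟨G, _, _, _, i, p, hp, hs, i_add, i_le, hpi, -⟩ := U.exists_embedding_of_invertible
    fun x hx => ⟨-x, by rw [(width_eq_zero_iff x).1 hx, hM']⟩
  have i_zero : i 0 = 0 := by simpa using i_add 0 0 width_zero width_zero
  refine ⟨G, _, _, inferInstance, U.isIsoToSubDom_gTilde hp hs i i_zero i_add
    (fun x hx => ?_) i_le hpi⟩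
  rw [← add_eq_zero_iff_eq_neg', ← i_add x _ hx ((width_neg x).trans hx),
    (width_eq_zero_iff x).1 hx, hM', i_zero]

theorem isIsoToSubDom_of_isSecondType (U : UpperRep M B) (hM : IsSecondType M) :
    ∃ (G : Type u) (_ : AddCommGroup G) (_ : LinearOrder G) (_ : IsOrderedAddMonoid G),
      IsIsoToSubDom M (DCut G) := by
  obtain ⟨G, _, _, _, i, p, hp, hs, i_add, i_le, hpi, hker⟩ :=
    U.exists_embedding_of_invertible fun x hx => hM.exists_add_eq_zero hx
  have i_zero : i 0 = 0 := by simpa using i_add 0 0 width_zero width_zero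
  have hwd : width (-0 : M) = 0 := (width_neg _).trans width_zero
  have hd : (-0 : M) < 0 := lt_of_le_of_ne axiomMA fun h => by
    have : (-0 : M) + -0 < -0 := hM
    rw [h, add_zero] at this
    exact this.false
  have i_lt : ∀ x y, width x = 0 → width y = 0 → (x < y ↔ i x < i y) := fun x y hx hy => by
    rw [← not_le, ← not_le, i_le y x hy hx]
  have hid : i (-0) < 0 := i_zero ▸ (i_lt _ _ hwd width_zero).1 hd
  have hpd : p (i (-0)) = 0 := (hpi _ hwd).trans U.shift_neg_zero
  -- A point strictly between `i δ` and `0` would lie over `0` in `B`, hence come from an element of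
  -- `M` strictly between `δ` and `0`.
  have hpred : ∀ a : G, a < 0 ↔ a ≤ i (-0) := fun a => by
    refine ⟨fun ha => not_lt.1 fun h => ?_, fun h => h.trans_lt hid⟩
    obtain ⟨x, hx, rfl⟩ := hker a (le_antisymm ((hp ha.le).trans_eq (map_zero p))
      (hpd.symm.trans_le (hp h.le)))
    rw [← i_lt _ _ hwd hx] at h
    rw [← i_zero, ← i_lt _ _ hx width_zero] at ha
    exact (nonneg_of_neg_zero_lt h).not_gt ha
  refine ⟨G, _, _, inferInstance, U.isIsoToSubDom_cut hp hs
    (fun x => DCut.ofLeft (Set.Iic (i x)) (isLowerSet_Iic _)) (by simp only [i_zero]; rfl)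
    (fun x y hx hy => ?_) (fun x hx => ?_) (fun x y hx hy => ?_) (fun x hx => ?_) (fun x hx => ?_)
    fun x hx g hg => hpi x hx ▸ hp hg⟩
  · rw [DCut.add_eq_translate (g := i x) rfl]
    apply DCut.ext_left
    rw [DCut.translate_left_of_eq_Iic (h := i y) rfl, ← i_add x y hx hy]
    rfl
  · apply DCut.ext_left
    ext z
    have h1 : i x + i (-x) = i (-0) := by
      rw [← i_add x _ hx ((width_neg x).trans hx), (width_eq_zero_iff x).1 hx]
    show z ≤ i (-x) ↔ _
    rw [DCut.mem_neg_left, eq_sub_of_add_eq ((add_comm _ _).trans h1), le_sub_iff_add_le, ← hpred]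
    show _ ↔ ¬ -z ≤ i x
    rw [not_le, lt_neg, ← sub_neg_eq_add, sub_neg]
  · rw [i_le x y hx hy, ← Set.Iic_subset_Iic]
    rfl
  · exact ⟨i x, le_refl (i x), hpi x hx⟩
  · refine ⟨i x - i (-0), ?_, by rw [map_sub, hpd, sub_zero, hpi x hx]⟩
    show ¬ i x - i (-0) ≤ i x
    rw [not_le]
    exact lt_sub_left_of_add_lt (by simpa using hid)

/-- Here `y + -x > δ`, hence `y + -x ≥ 0`. If it were positive, adding `δ` would leave it above `δ`;
but `δ + y + -x = δ + x + -x = δ`. -/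
theorem add_neg_eq_zero_of_lt (hd : (-0 : M) + -0 = -0) {x y : M} (hx : width x = 0)
    (hxy : -0 + x = -0 + y) (h : x < y) : y + -x = 0 := by
  have h1 : -0 < y + -x := (lt_iff_neg_zero_lt x y).1 h
  refine le_antisymm (not_lt.1 fun h2 => ?_) (nonneg_of_neg_zero_lt h1)
  have h3 : -(0 : M) < y + -x + -0 := (lt_iff_neg_zero_lt _ _).1 h2
  rw [add_comm, ← add_assoc, ← hxy, add_assoc, (width_eq_zero_iff x).1 hx, hd] at h3
  exact h3.false

/-- Otherwise `δ = x + -x` would be invertible, and an invertible idempotent is `0`. -/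
theorem not_invertible_neg (hM : IsThirdType M) {x y z : M} (hx : width x = 0) (h : x + y = 0) :
    -x + z ≠ 0 := fun h' => by
  have hd : (-0 : M) + -0 = -0 := hM.1
  have h1 : -0 + (y + z) = 0 := by
    rw [← (width_eq_zero_iff x).1 hx, add_add_add_comm, h, h', add_zero]
  have h2 : (-0 : M) = 0 := by
    have := add_assoc (-0 : M) (-0) (y + z)
    rwa [hd, h1, add_zero, eq_comm] at this
  exact hM.2.ne h2

theorem width_of_add_eq_neg_zero {x y : M} (h : x + y = -0) : width x = 0 := by
  rw [width_eq_zero_iff]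
  refine le_antisymm (add_neg_le x) (h.symm.trans_le (add_le_add_right ?_ x))
  rw [le_neg_iff, add_comm, h]

/-- The elements of width zero of a dom of the third type map to an ordered group with a dense
subgroup that contains the images of the invertible elements and of their opposites, and no
others. -/
theorem exists_embedding_of_isThirdType (U : UpperRep M B) (hM : IsThirdType M) :
    ∃ (E : Type u) (_ : AddCommGroup E) (_ : LinearOrder E) (_ : IsOrderedAddMonoid E)
      (T : AddSubgroup E) (i : M → E) (p : E →+ B), Monotone p ∧ Function.Surjective p ∧
        (∀ x y, width x = 0 → width y = 0 → i (x + y) = i x + i y) ∧ i (-0) = 0 ∧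
        (∀ x y, width x = 0 → width y = 0 → (-0 + x ≤ -0 + y ↔ i x ≤ i y)) ∧
        (∀ x, width x = 0 → p (i x) = U.shift x) ∧
        (∀ x, width x = 0 → (i x ∈ T ↔ ∃ y z, y + z = 0 ∧ -0 + y = -0 + x)) ∧
        (∀ a b, a < b → ∃ t ∈ T, a < t ∧ t < b) ∧ ∃ ε, 0 < ε ∧ p ε = 0 := by
  have hd : (-0 : M) + -0 = -0 := hM.1
  have hwd : width (-0 : M) = 0 := (width_neg _).trans width_zero
  -- Modulo `δ`, every core element `x` is invertible, with inverse the class of `-x`.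
  have h : ∀ x : M, ∃ a : AddUnits (Absorbing (-0 : M) hd),
      width x = 0 → a.1 = Absorbing.proj hd x :=
    fun x => by
      by_cases hx : width x = 0
      · have h : Absorbing.proj hd x + Absorbing.proj hd (-x) = 0 := by
          rw [← Absorbing.proj_add, (width_eq_zero_iff x).1 hx]
          exact Subtype.ext hd
        exact ⟨⟨_, _, h, (add_comm _ _).trans h⟩, fun _ => rfl⟩
      · exact ⟨0, fun h => absurd h hx⟩
  choose τ hτ using h
  have hw : ∀ a : AddUnits (Absorbing (-0 : M) hd), width a.1.1 = 0 := fun a =>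
    width_of_add_eq_neg_zero (congrArg Subtype.val a.add_neg)
  let f : AddUnits (Absorbing (-0 : M) hd) →+ B :=
    { toFun := fun a => U.shift a.1.1
      map_zero' := U.shift_neg_zero
      map_add' := fun a b => U.shift_add a.1.1 b.1.1 (hw a) (hw b) }
  obtain ⟨G, _, _, _, i, p, hi, hp, hs, hpi, -⟩ :=
    exists_strictMono_surjective_factorization f
      fun a b h => U.shift_mono a.1.1 b.1.1 (hw a) (hw b) h
  let π : M →+ Absorbing (-0 : M) hd :=
    { toFun := Absorbing.proj hd, map_zero' := Absorbing.proj_zero, map_add' := Absorbing.proj_add }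
  -- The prescribed subgroup is the image of the invertible elements of `M`.
  obtain ⟨E, _, _, _, T, j, q, hj, hq, hqj, hT, hdense, ε, hε, hqε⟩ :=
    exists_dense_addSubgroup (((AddUnits.map π).range).map i)
  have τ_add : ∀ x y, width x = 0 → width y = 0 → τ (x + y) = τ x + τ y := fun x y hx hy => by
    refine AddUnits.ext ?_
    rw [AddUnits.val_add, hτ x hx, hτ y hy, hτ _ (width_add_eq_zero hx hy), Absorbing.proj_add]
  refine ⟨E, _, _, inferInstance, T, fun x => j (i (τ x)), p.comp q, hp.comp hq,
    hs.comp fun a => ⟨j a, hqj a⟩, fun x y hx hy => ?_, ?_, fun x y hx hy => ?_, fun x hx => ?_,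
    fun x hx => ?_, hdense, ε, hε, by simp [hqε]⟩
  · simp only [τ_add x y hx hy, map_add]
  · have h := τ_add _ _ hwd hwd
    rw [hd, left_eq_add] at h
    simp only [h, map_zero]
  · rw [hj.le_iff_le, hi.le_iff_le, ← AddUnits.val_le_val, hτ x hx, hτ y hy]
    rfl
  · rw [AddMonoidHom.comp_apply, hqj, hpi]
    show U.shift (τ x).1.1 = _
    rw [hτ x hx]
    show U.shift (-0 + x) = _
    rw [U.shift_add _ _ hwd hx, U.shift_neg_zero, zero_add]
  · rw [hT, AddSubgroup.mem_map]
    constructor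
    · rintro ⟨_, ⟨v, rfl⟩, hv⟩
      have h1 := congrArg AddUnits.val (hi.injective hv)
      rw [hτ x hx] at h1
      exact ⟨v.1, v.2, v.3, congrArg Subtype.val h1⟩
    · rintro ⟨y, z, hyz, hyx⟩
      refine ⟨_, ⟨⟨y, z, hyz, (add_comm _ _).trans hyz⟩, rfl⟩, congrArg i (AddUnits.ext ?_)⟩
      rw [hτ x hx]
      exact Subtype.ext hyx

theorem isIsoToSubDom_of_isThirdType (U : UpperRep M B) (hM : IsThirdType M) :
    ∃ (G : Type u) (_ : AddCommGroup G) (_ : LinearOrder G) (_ : IsOrderedAddMonoid G),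
      IsIsoToSubDom M (DCut G) := by
  have hd : (-0 : M) + -0 = -0 := hM.1
  have hwd : width (-0 : M) = 0 := (width_neg _).trans width_zero
  obtain ⟨E, _, _, _, T, i, p, hp, hs, i_add, i_delta, i_le, hpi, hT, hdense, ε, hε, hpε⟩ :=
    U.exists_embedding_of_isThirdType hM
  have i_zero : i 0 = 0 := by simpa using i_add 0 0 width_zero width_zero
  have i_mono : ∀ x y, width x = 0 → width y = 0 → x ≤ y → i x ≤ i y := fun x y hx hy h =>
    (i_le x y hx hy).1 (add_le_add_right h _)
  have i_neg : ∀ x, width x = 0 → i (-x) = -i x := fun x hx => by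
    rw [← add_eq_zero_iff_eq_neg', ← i_add x _ hx ((width_neg x).trans hx),
      (width_eq_zero_iff x).1 hx, i_delta]
  have i_eq : ∀ x y, width x = 0 → width y = 0 → i x = i y → -0 + x = -0 + y := fun x y hx hy h =>
    le_antisymm ((i_le x y hx hy).2 h.le) ((i_le y x hy hx).2 h.ge)
  have mem_of_inv : ∀ x y, width x = 0 → x + y = 0 → i x ∈ T := fun x y hx hxy =>
    (hT x hx).2 ⟨x, y, hxy, rfl⟩
  have between : ∀ a b, a < b → p a = p b → ∃ t ∈ T, a < t ∧ t < b ∧ p t = p b :=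
    fun a b hab h => by
      obtain ⟨t, ht, h1, h2⟩ := hdense a b hab
      exact ⟨t, ht, h1, h2, le_antisymm (hp h2.le) (h.symm.trans_le (hp h1.le))⟩
  -- The cut of `T` at `i x`, with `i x` itself on the left exactly when `x` is invertible.
  let c : M → DCut T := fun x => DCut.ofLeft
    {g | g.1 < i x ∨ g.1 = i x ∧ ∃ y, x + y = 0} (fun a b hba ha => by
      rcases lt_or_eq_of_le hba with h | rfl
      · exact Or.inl (lt_of_lt_of_le (b := a.1) h (ha.elim le_of_lt fun h => h.1.le))
      · exact ha)
  have mem_c : ∀ {x} {g : T}, g ∈ (c x).left ↔ g.1 < i x ∨ g.1 = i x ∧ ∃ y, x + y = 0 := Iff.rfl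
  have c_mono : ∀ x y, width x = 0 → width y = 0 → x ≤ y → c x ≤ c y := fun x y hx hy h g hg => by
    rcases (i_mono x y hx hy h).lt_or_eq with h' | h'
    · exact Or.inl (hg.elim (fun h => h.trans h') fun h => h.1.trans_lt h')
    · refine hg.imp (fun h => h.trans_eq h') fun h2 => ⟨h2.1.trans h', ?_⟩
      rcases h.lt_or_eq with h | rfl
      · exact ⟨_, add_neg_eq_zero_of_lt hd hx (i_eq x y hx hy h') h⟩
      · exact h2.2
  refine ⟨T, inferInstance, inferInstance, inferInstance,
    U.isIsoToSubDom_cut (p := p.comp T.subtype) (fun a b h => hp h) (fun b => ?_) c ?_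
    (fun x y hx hy => ?_) (fun x hx => ?_) (fun x y hx hy => ⟨c_mono x y hx hy, fun h => ?_⟩)
    (fun x hx => ?_) (fun x hx => ?_) fun x hx g hg => ?_⟩
  -- As `p ε = 0`, the interval from `a - ε` to `a` lies in one fibre, and `T` meets it by density.
  · obtain ⟨a, rfl⟩ := hs b
    obtain ⟨t, ht, -, -, h⟩ := between (a - ε) a (sub_lt_self a hε) (by rw [map_sub, hpε, sub_zero])
    exact ⟨⟨t, ht⟩, h⟩
  · apply DCut.ext_left
    ext g
    rw [mem_c, DCut.mem_zero_left, i_zero]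
    refine Iff.trans ?_ (le_iff_lt_or_eq (a := g.1) (b := 0)).symm
    exact or_congr_right (and_iff_left ⟨0, add_zero 0⟩)
  · apply DCut.ext_left
    ext g
    rw [mem_c, DCut.mem_add_left, i_add x y hx hy]
    constructor
    · rintro (h | ⟨h, z, hz⟩)
      · obtain ⟨t, ht, h1, h2⟩ := hdense (g.1 - i x) (i y) (sub_lt_iff_lt_add'.2 h)
        exact ⟨g - ⟨t, ht⟩, Or.inl (sub_lt_comm.1 h1), ⟨t, ht⟩, Or.inl h2, by abel⟩
      · have hx' : x + (y + z) = 0 := by rw [← add_assoc, hz]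
        have hy' : y + (x + z) = 0 := by rw [add_left_comm, ← add_assoc, hz]
        exact ⟨⟨i x, mem_of_inv _ _ hx hx'⟩, Or.inr ⟨rfl, _, hx'⟩, ⟨i y, mem_of_inv _ _ hy hy'⟩,
          Or.inr ⟨rfl, _, hy'⟩, Subtype.ext h⟩
    · rintro ⟨a, ha | ⟨ha, x', hx'⟩, b, hb | ⟨hb, y', hy'⟩, rfl⟩
      · exact Or.inl (add_lt_add ha hb)
      · exact Or.inl (add_lt_add_of_lt_of_le ha hb.le)
      · exact Or.inl (add_lt_add_of_le_of_lt ha.le hb)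
      · exact Or.inr ⟨congrArg₂ (· + ·) ha hb, x' + y', by
          rw [add_add_add_comm, hx', hy', add_zero]⟩
  · apply DCut.ext_left
    ext g
    have hx' := (width_neg x).trans hx
    rw [DCut.mem_neg_left, mem_c, mem_c, i_neg x hx, not_or, not_and, not_lt]
    show _ ↔ i x ≤ -g.1 ∧ (-g.1 = i x → _)
    constructor
    · rintro (h | ⟨h, z, hz⟩)
      · exact ⟨(lt_neg.1 h).le, fun h' => absurd h' (lt_neg.1 h).ne'⟩
      · exact ⟨(le_neg.1 h.le), fun _ ⟨y, hy⟩ => not_invertible_neg hM hx hy hz⟩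
    · rintro ⟨h1, h2⟩
      rcases h1.lt_or_eq with h | h
      · exact Or.inl (lt_neg.1 h)
      · refine Or.inr ⟨neg_eq_iff_eq_neg.1 h.symm, ?_⟩
        -- Since `i x ∈ T`, the class of `x` has an invertible element `y`. As `x` is not
        -- invertible, `x < y`, and then `-x` is invertible.
        obtain ⟨y, z, hyz, hyx⟩ := (hT x hx).1 (h ▸ T.neg_mem g.2)
        have hni := h2 h.symm
        have hy : width y = 0 := width_eq_zero_of_add_eq_zero hyz
        rcases lt_trichotomy x y with h | rfl | h
        · exact ⟨y, (add_comm _ _).trans (add_neg_eq_zero_of_lt hd hx hyx.symm h)⟩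
        · exact absurd ⟨z, hyz⟩ hni
        · exact absurd ⟨_, add_neg_eq_zero_of_lt hd hy hyx h⟩ hni
  · by_contra! hlt
    -- Either a point of `T` separates `i y` from `i x`, or `x` and `y` share a class; then `x`, the
    -- greater, is invertible and `y` is not, so the cuts differ at `i x`.
    rcases (i_mono y x hy hx hlt.le).lt_or_eq with h' | h'
    · obtain ⟨t, ht, h1, h2⟩ := hdense _ _ h'
      rcases h (a := ⟨t, ht⟩) (Or.inl h2) with h3 | h3
      exacts [h3.not_gt h1, h1.ne' h3.1]
    · have h0 := add_neg_eq_zero_of_lt hd hy (i_eq y x hy hx h') hlt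
      rcases h (a := ⟨i x, mem_of_inv _ _ hx h0⟩) (Or.inr ⟨rfl, _, h0⟩) with h3 | ⟨-, z, hz⟩
      · exact h3.ne' h'
      · exact not_invertible_neg hM hy hz ((add_comm _ _).trans h0)
  · obtain ⟨t, ht, -, h2, h⟩ := between (i x - ε) (i x) (sub_lt_self _ hε)
      (by rw [map_sub, hpε, sub_zero])
    exact ⟨⟨t, ht⟩, Or.inl h2, h.trans (hpi x hx)⟩
  · obtain ⟨t, ht, h1, -, h⟩ := between (i x) (i x + ε) (lt_add_of_pos_right _ hε)
      (by rw [map_add, hpε, add_zero])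
    refine ⟨⟨t, ht⟩, fun h3 => ?_, h.trans (by rw [map_add, hpε, add_zero, hpi x hx])⟩
    rcases h3 with h3 | h3
    exacts [h3.not_gt h1, h1.ne' h3.1]
  · rw [← hpi x hx]
    exact hp (hg.elim le_of_lt fun h => h.1.le)

end UpperRep

/-! ### The induction and the conclusion -/

namespace Dom

/-- A dom of the second or of the third type with finitely many widths is a dom of cuts. -/
theorem exists_isIsoToSubDom_cut (n : ℕ) : ∀ (M : Type u) [Dom M], (widths M).Finite →
    (widths M).ncard = n → ¬ IsFirstType M → ∃ (G : Type u) (_ : AddCommGroup G)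
      (_ : LinearOrder G) (_ : IsOrderedAddMonoid G), IsIsoToSubDom M (DCut G) := by
  induction n using Nat.strong_induction_on with
  | _ n ih =>
    intro M _ hW hn hM
    obtain ⟨B, _, _, _, ⟨U⟩⟩ := exists_upperRep M hW fun N _ hN hlt hN' =>
      ih _ (hn ▸ hlt) N hN rfl hN'
    rcases (neg_zero_add_neg_zero_le (M := M)).lt_or_eq with h | h
    · exact U.isIsoToSubDom_of_isSecondType h
    · exact U.isIsoToSubDom_of_isThirdType ⟨h, lt_of_le_of_ne axiomMA hM⟩

end Dom

theorem corollary5p14 (M : Type u) [Dom M] (hW : (Dom.widths M).Finite) :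
    ∃ (G : Type u) (_ : AddCommGroup G) (_ : LinearOrder G) (_ : IsOrderedAddMonoid G),
      (Dom.IsFirstType M → IsIsoToSubDom M (GTilde G)) ∧
      (Dom.IsSecondType M ∨ Dom.IsThirdType M → IsIsoToSubDom M (DCut G)) := by
  by_cases hM : Dom.IsFirstType M
  -- The first type can occur only at the top level, so one more application of the inductive step
  -- suffices.
  · obtain ⟨B, _, _, _, ⟨U⟩⟩ := Dom.exists_upperRep M hW fun N _ hN _ hN' =>
      Dom.exists_isIsoToSubDom_cut _ N hN rfl hN'
    obtain ⟨G, h1, h2, h3, hG⟩ := U.isIsoToSubDom_of_isFirstType hM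
    refine ⟨G, h1, h2, h3, fun _ => hG, fun h => ?_⟩
    have hM' : Dom.delta M = 0 := hM
    rcases h with h | h
    · rw [Dom.IsSecondType, hM', add_zero] at h
      exact absurd h (lt_irrefl _)
    · exact absurd hM' h.2.ne
  · obtain ⟨G, h1, h2, h3, hG⟩ := Dom.exists_isIsoToSubDom_cut _ M hW rfl hM
    exact ⟨G, h1, h2, h3, fun h => absurd h hM, fun _ => hG⟩
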